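/- Let $R$ be an associative ring with identity; modules are left $R$-modules. Let $n\in\{0,1,2,\dots\}\cup\{\infty\}$, with the convention $\infty+1=\infty$. Let $\mathcal{P}^{<n+1}$ be the class of modules $M$ admitting an exact sequence $0\to P_k\to\cdots\to P_1\to P_0\to M\to 0$ with all $P_i$ finitely generated projective and $k<n+1$ a natural number (for $n=\infty$, any finite length $k$ is allowed; members of $\mathcal{P}^{<\infty}$ are said to have a finite projective resolution). Let $l.\mathrm{fPD}(R)$ be the supremum of the projective dimensions of all modules in $\mathcal{P}^{<\infty}$. A short exact sequence $0\to A\to B\to C\to 0$ is called $n$-exact if $0\to\mathrm{Hom}_R(M,A)\to\mathrm{Hom}_R(M,B)\to\mathrm{Hom}_R(M,C)\to 0$ is exact for every $M\in\mathcal{P}^{<n+1}$, and pure exact if this holds for every finitely presented $M$. A module $N$ is called $n$-projective (resp. pure projective) if $0\to\mathrm{Hom}_R(N,A)\to\mathrm{Hom}_R(N,B)\to\mathrm{Hom}_R(N,C)\to 0$ is exact for every $n$-exact (resp. pure exact) sequence $0\to A\to B\to C\to 0$. The ring $R$ is left coherent if every finitely generated left ideal is finitely presented. (1) The following statements are equivalent,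 where $m$ ranges over $\{0,1,2,\dots\}\cup\{\infty\}$ (for finite $n$, the condition $m\ge n+1$ means $m>n$; for $n=\infty$ it means $m=\infty$): (a) $l.\mathrm{fPD}(R)\le n$; (b) every $(n+1)$-projective module is $n$-projective; (c) there is some $m\ge n+1$ such that every $m$-projective module is $n$-projective; (d) for all $m\ge n+1$, every $m$-projective module is $n$-projective; (e) every $\infty$-projective module is $n$-projective. (2) The following statements are equivalent: (a) $R$ is left coherent and every finitely presented module has projective dimension $<n+1$ (for $n=\infty$: finite projective dimension); (b) every pure projective module is $n$-projective. -/

import Mathlib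

universe u

namespace FiniteProjRes

section

variable (R : Type u) [Ring R]

/-- `M` admits an exact sequence `0 → P k → ⋯ → P 1 → P 0 → M → 0` in which every `P i` is a
finitely generated projective left `R`-module. The sequence is indexed by all natural numbers and
extended by zero modules beyond degree `k`. -/
def HasResolutionOfLength (k : ℕ) (M : Type u) [AddCommGroup M] [Module R M] : Prop :=
  ∃ (P : ℕ → ModuleCat.{u} R) (d : ∀ i, P (i + 1) →ₗ[R] P i) (ε : P 0 →ₗ[R] M),
    (∀ i, Module.Finite R (P i)) ∧
    (∀ i, Module.Projective R (P i)) ∧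
    (∀ i, k < i → Subsingleton (P i)) ∧
    (∀ i, Function.Exact (d (i + 1)) (d i)) ∧
    Function.Exact (d 0) ε ∧
    Function.Surjective ε

/-- The class `𝒫^{< n+1}`, for `n` a natural number or `∞` (with `∞ + 1 = ∞`): the left modules
with a finite resolution by finitely generated projectives of length less than `n + 1`. For
`n = ∞` any finite length is allowed, and the class is that of all modules having a finite
projective resolution. -/
def ClassP (n : ℕ∞) (M : Type u) [AddCommGroup M] [Module R M] : Prop :=
  ∃ k : ℕ, (k : ℕ∞) < n + 1 ∧ HasResolutionOfLength R k M

/-- The class of all modules with a finite resolution by finitely generated projectives. -/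
def HasFiniteProjectiveResolution (M : Type u) [AddCommGroup M] [Module R M] : Prop :=
  ∃ k : ℕ, HasResolutionOfLength R k M

/-- The projective dimension of a left module, with value `⊥` for the zero module and `⊤` for
modules of infinite projective dimension. -/
noncomputable def projDim (M : Type u) [AddCommGroup M] [Module R M] : WithBot ℕ∞ :=
  CategoryTheory.projectiveDimension (ModuleCat.of R M)

/-- The left little finitistic dimension `l.fPD(R)`: the supremum of the projective dimensions of
the left modules having a finite projective resolution. -/
noncomputable def littleFinitisticDim : WithBot ℕ∞ :=
  ⨆ (M : ModuleCat.{u} R) (_ : HasFiniteProjectiveResolution R M), projDim R M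

end

section

variable {R : Type u} [Ring R]
variable {A B C : Type u} [AddCommGroup A] [Module R A] [AddCommGroup B] [Module R B]
  [AddCommGroup C] [Module R C]

/-- The sequence `0 → A → B → C → 0` given by `f` and `g` is exact. -/
def IsShortExact (f : A →ₗ[R] B) (g : B →ₗ[R] C) : Prop :=
  Function.Injective f ∧ Function.Exact f g ∧ Function.Surjective g

/-- The sequence `0 → Hom_R(M, A) → Hom_R(M, B) → Hom_R(M, C) → 0` induced by `f` and `g` is
exact. -/
def IsHomExact (M : Type u) [AddCommGroup M] [Module R M]
    (f : A →ₗ[R] B) (g : B →ₗ[R] C) : Prop :=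
  Function.Injective (fun φ : M →ₗ[R] A => f ∘ₗ φ) ∧
  Function.Exact (fun φ : M →ₗ[R] A => f ∘ₗ φ) (fun ψ : M →ₗ[R] B => g ∘ₗ ψ) ∧
  Function.Surjective (fun ψ : M →ₗ[R] B => g ∘ₗ ψ)

/-- `n`-exact short exact sequences: those that stay exact under `Hom_R(M, -)` for all
`M ∈ 𝒫^{< n+1}`. -/
def IsNExact (n : ℕ∞) (f : A →ₗ[R] B) (g : B →ₗ[R] C) : Prop :=
  IsShortExact f g ∧
    ∀ (M : Type u) [AddCommGroup M] [Module R M], ClassP R n M → IsHomExact M f g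

/-- Pure exact sequences of left modules: short exact sequences that stay exact under
`Hom_R(M, -)` for all finitely presented left modules `M`. -/
def IsPureExact (f : A →ₗ[R] B) (g : B →ₗ[R] C) : Prop :=
  IsShortExact f g ∧
    ∀ (M : Type u) [AddCommGroup M] [Module R M], Module.FinitePresentation R M →
      IsHomExact M f g

end

section

variable (R : Type u) [Ring R]

/-- `n`-projective modules: projective with respect to all `n`-exact sequences. -/
def IsNProjective (n : ℕ∞) (M : Type u) [AddCommGroup M] [Module R M] : Prop :=
  ∀ (A B C : Type u) [AddCommGroup A] [Module R A] [AddCommGroup B] [Module R B]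
    [AddCommGroup C] [Module R C] (f : A →ₗ[R] B) (g : B →ₗ[R] C),
    IsNExact n f g → IsHomExact M f g

/-- Pure projective modules: projective with respect to all pure exact sequences. -/
def IsPureProjective (M : Type u) [AddCommGroup M] [Module R M] : Prop :=
  ∀ (A B C : Type u) [AddCommGroup A] [Module R A] [AddCommGroup B] [Module R B]
    [AddCommGroup C] [Module R C] (f : A →ₗ[R] B) (g : B →ₗ[R] C),
    IsPureExact f g → IsHomExact M f g

/-- `R` is left coherent: every finitely generated left ideal is finitely presented. -/
def IsLeftCoherent : Prop :=
  ∀ I : Submodule R R, I.FG → Module.FinitePresentation R I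

end

end FiniteProjRes

/-! Both parts reduce to inclusions between classes of finitely generated modules. The bridge is
`IsNProjective.classP`: a finitely generated `n`-projective module lies in `𝒫^{<n+1}`, being a
retract of a finite direct sum of members, and the class is closed under finite sums and retracts.
For (1), any of the projectivity conditions thus puts `𝒫^{<n+2}` inside `𝒫^{<n+1}`; shortening
resolutions one step at a time then puts all of `𝒫^{<∞}` there. This amounts to `l.fPD(R) ≤ n`,
since a finite resolution can be cut down to the projective dimension. Conversely, such an inclusion
makes `n`-exact sequences `m`-exact. For (2), the class compared with `𝒫^{<n+1}` is that of the
finitely presented modules, and coherence is what keeps their syzygies finitely presented. -/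

namespace FiniteProjRes

open CategoryTheory

/-! ### Finite resolutions through syzygies -/

section

variable {R : Type u} [Ring R]

variable (R) in
/-- `M` has a resolution of length at most `k` by finitely generated projective modules,
described by recursion on `k` through the first syzygy. -/
def FinProjResLE : ℕ → ∀ (M : Type u) [AddCommGroup M] [Module R M], Prop
  | 0, M, _, _ => Module.Finite R M ∧ Module.Projective R M
  | k + 1, M, _, _ => ∃ (P K : ModuleCat.{u} R) (i : K →ₗ[R] P) (f : P →ₗ[R] M),
      Module.Finite R P ∧ Module.Projective R P ∧ IsShortExact i f ∧ FinProjResLE k K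

section

variable {M N : Type u} [AddCommGroup M] [Module R M] [AddCommGroup N] [Module R N]

theorem isShortExact_ker_subtype {f : M →ₗ[R] N} (hf : Function.Surjective f) :
    IsShortExact (LinearMap.ker f).subtype f :=
  ⟨Subtype.val_injective, LinearMap.exact_subtype_ker_map f, hf⟩

theorem FinProjResLE.succ_of_surjective {k : ℕ} [Module.Finite R M] [Module.Projective R M]
    {f : M →ₗ[R] N} (hf : Function.Surjective f) (h : FinProjResLE R k (LinearMap.ker f)) :
    FinProjResLE R (k + 1) N :=
  ⟨.of R M, .of R (LinearMap.ker f), (LinearMap.ker f).subtype, f, ‹_›, ‹_›,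
    isShortExact_ker_subtype hf, h⟩

theorem FinProjResLE.finite {k : ℕ} (h : FinProjResLE R k M) : Module.Finite R M := by
  cases k with
  | zero => exact h.1
  | succ k =>
    obtain ⟨P, K, i, f, hP, -, hf, -⟩ := h
    exact Module.Finite.of_surjective f hf.2.2

theorem FinProjResLE.of_equiv {k : ℕ} (h : FinProjResLE R k M) (e : M ≃ₗ[R] N) :
    FinProjResLE R k N := by
  cases k with
  | zero =>
    obtain ⟨h₁, h₂⟩ := h
    exact ⟨Module.Finite.equiv e, Module.Projective.of_equiv e⟩
  | succ k =>
    obtain ⟨P, K, i, f, h₁, h₂, ⟨h₃, h₄, h₅⟩, h₆⟩ := h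
    refine ⟨P, K, i, e.toLinearMap ∘ₗ f, h₁, h₂, ⟨h₃, fun x => ?_, e.surjective.comp h₅⟩, h₆⟩
    simpa using h₄ x

theorem FinProjResLE.prod {k : ℕ} (hM : FinProjResLE R k M) (hN : FinProjResLE R k N) :
    FinProjResLE R k (M × N) := by
  induction k generalizing M N with
  | zero =>
    obtain ⟨_, _⟩ := hM
    obtain ⟨_, _⟩ := hN
    exact ⟨inferInstance, inferInstance⟩
  | succ k ih =>
    obtain ⟨P, K, i, f, _, _, ⟨hi, hif, hf⟩, hK⟩ := hM
    obtain ⟨Q, L, j, g, _, _, ⟨hj, hjg, hg⟩, hL⟩ := hN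
    refine ⟨.of R (P × Q), .of R (K × L), i.prodMap j, f.prodMap g,
      inferInstanceAs (Module.Finite R (P × Q)), inferInstanceAs (Module.Projective R (P × Q)),
      ⟨hi.prodMap hj, ?_, hf.prodMap hg⟩, ih hK hL⟩
    rintro ⟨x, y⟩
    have h₁ := hif x
    have h₂ := hjg y
    simp only [LinearMap.prodMap_apply, Prod.mk_eq_zero, h₁, h₂, Set.mem_range, Prod.exists,
      Prod.mk.injEq]
    exact ⟨fun ⟨⟨a, ha⟩, b, hb⟩ => ⟨a, b, ha, hb⟩, fun ⟨a, b, ha, hb⟩ => ⟨⟨a, ha⟩, b, hb⟩⟩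

theorem FinProjResLE.of_projective (k : ℕ) [Module.Finite R M] [Module.Projective R M] :
    FinProjResLE R k M := by
  induction k generalizing M with
  | zero => exact ⟨‹_›, ‹_›⟩
  | succ k ih =>
    refine ⟨.of R M, .of R PUnit, 0, .id, ‹_›, ‹_›, ⟨?_, ?_, ?_⟩, ih⟩
    · exact Function.injective_of_subsingleton _
    · intro x
      simp [eq_comm]
    · exact Function.surjective_id

theorem FinProjResLE.succ {k : ℕ} (h : FinProjResLE R k M) : FinProjResLE R (k + 1) M := by
  induction k generalizing M with
  | zero =>
    obtain ⟨_, _⟩ := h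
    exact .of_projective 1
  | succ k ih =>
    obtain ⟨P, K, i, f, h₁, h₂, h₃, h₄⟩ := h
    exact ⟨P, K, i, f, h₁, h₂, h₃, ih h₄⟩

theorem FinProjResLE.mono {k l : ℕ} (h : FinProjResLE R k M) (hkl : k ≤ l) :
    FinProjResLE R l M := by
  induction l, hkl using Nat.le_induction with
  | base => exact h
  | succ l _ ih => exact ih.succ

theorem ker_equiv_of_isShortExact {A B C : Type u} [AddCommGroup A] [Module R A]
    [AddCommGroup B] [Module R B] [AddCommGroup C] [Module R C] {f : A →ₗ[R] B} {g : B →ₗ[R] C}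
    (h : IsShortExact f g) : Nonempty (A ≃ₗ[R] LinearMap.ker g) :=
  ⟨(LinearEquiv.ofInjective f h.1).trans
    (LinearEquiv.ofEq _ _ (LinearMap.exact_iff.1 h.2.1).symm)⟩

/-- If `M` is a retract of `N`, then the kernel of a surjection from a projective module onto `M`
is a retract of `ker f × Q`, for `f` a surjection from a projective module onto `N`. -/
theorem exists_retract_ker {P Q : Type u} [AddCommGroup P] [Module R P] [AddCommGroup Q]
    [Module R Q] [Module.Projective R P] [Module.Projective R Q]
    {f : P →ₗ[R] N} (hf : Function.Surjective f) {g : Q →ₗ[R] M} (hg : Function.Surjective g)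
    {i : M →ₗ[R] N} {r : N →ₗ[R] M} (hri : r ∘ₗ i = .id) :
    ∃ (j : LinearMap.ker g →ₗ[R] LinearMap.ker f × Q)
      (s : LinearMap.ker f × Q →ₗ[R] LinearMap.ker g), s ∘ₗ j = .id := by
  obtain ⟨a, ha⟩ := Module.projective_lifting_property f (i ∘ₗ g) hf
  obtain ⟨b, hb⟩ := Module.projective_lifting_property g (r ∘ₗ f) hg
  replace ha (x) : f (a x) = i (g x) := LinearMap.congr_fun ha x
  replace hb (x) : g (b x) = r (f x) := LinearMap.congr_fun hb x
  replace hri (x) : r (i x) = x := LinearMap.congr_fun hri x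
  -- As in Schanuel's lemma: `x ↦ (a x, x)` and `(y, q) ↦ b y + (q - b (a q))`. The second lands in
  -- `ker g` because `g (b (a q)) = r (i (g q)) = g q`.
  refine ⟨((a ∘ₗ (LinearMap.ker g).subtype).codRestrict _ fun x => ?_).prod
    (LinearMap.ker g).subtype,
    ((b ∘ₗ (LinearMap.ker f).subtype).coprod (.id - b ∘ₗ a)).codRestrict _ fun x => ?_, ?_⟩
  · simp [ha]
  · simp [ha, hb, hri]
  · refine LinearMap.ext fun x => Subtype.ext ?_
    exact add_sub_cancel (b (a x)) (x : Q)

/-- Retracts pass to syzygies up to a finitely generated free summand, which does not affect the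
length, so induction on `k` applies. -/
theorem FinProjResLE.of_retract {k : ℕ} (h : FinProjResLE R k N) {i : M →ₗ[R] N}
    {r : N →ₗ[R] M} (hri : r ∘ₗ i = .id) : FinProjResLE R k M := by
  have hr : Function.Surjective r := fun x => ⟨i x, LinearMap.congr_fun hri x⟩
  have := h.finite
  have hM : Module.Finite R M := .of_surjective r hr
  induction k generalizing M N with
  | zero =>
    have := h.2
    exact ⟨hM, .of_split i r hri⟩
  | succ k ih =>
    obtain ⟨P, K, t, f, hP, _, hs, hK⟩ := h
    obtain ⟨e⟩ := ker_equiv_of_isShortExact hs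
    obtain ⟨s, g, hg⟩ := Module.Finite.exists_fin' R M
    obtain ⟨j, q, hq⟩ := exists_retract_ker hs.2.2 hg hri
    have hKQ := (hK.of_equiv e).prod (FinProjResLE.of_projective (R := R) (M := Fin s → R) k)
    have hq' : Function.Surjective q := fun x => ⟨j x, LinearMap.congr_fun hq x⟩
    have := hKQ.finite
    exact .succ_of_surjective hg (ih hKQ hq hq' this (.of_surjective q hq'))

/-- Frees the recursion from the chosen presentation: the kernel of any other one is a retract of `K
× M`. -/
theorem FinProjResLE.ker {k : ℕ} [Module.Finite R M] [Module.Projective R M] {f : M →ₗ[R] N}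
    (hf : Function.Surjective f) (h : FinProjResLE R (k + 1) N) :
    FinProjResLE R k (LinearMap.ker f) := by
  obtain ⟨P, K, t, g, hP, _, hs, hK⟩ := h
  obtain ⟨e⟩ := ker_equiv_of_isShortExact hs
  obtain ⟨j, q, hq⟩ := exists_retract_ker hs.2.2 hf (i := .id) (r := .id) rfl
  exact ((hK.of_equiv e).prod (.of_projective k)).of_retract hq

end

/-! ### Comparison with resolutions as sequences -/

theorem HasResolutionOfLength.finProjResLE {k : ℕ} {M : Type u} [AddCommGroup M] [Module R M]
    (h : HasResolutionOfLength R k M) : FinProjResLE R k M := by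
  induction k generalizing M with
  | zero =>
    obtain ⟨P, d, ε, _, _, h0, hd, hε, hs⟩ := h
    have := h0 1 one_pos
    have hinj : Function.Injective ε := by
      rw [injective_iff_map_eq_zero]
      intro x hx
      obtain ⟨y, rfl⟩ := (hε x).1 hx
      rw [Subsingleton.elim y 0, map_zero]
    exact (FinProjResLE.of_projective 0).of_equiv (LinearEquiv.ofBijective ε ⟨hinj, hs⟩)
  | succ k ih =>
    obtain ⟨P, d, ε, _, _, h0, hd, hε, hs⟩ := h
    refine .succ_of_surjective hs (ih ⟨fun i => P (i + 1), fun i => d (i + 1),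
      (d 0).codRestrict _ fun x => hε.apply_apply_eq_zero x, fun i => inferInstance,
      fun i => inferInstance, fun i hi => h0 _ (by lia), fun i => hd _, fun x => ?_, ?_⟩)
    · rw [← hd 0 x, Subtype.ext_iff]
      rfl
    · rintro ⟨x, hx⟩
      obtain ⟨y, rfl⟩ := (hε x).1 hx
      exact ⟨y, rfl⟩

theorem FinProjResLE.hasResolutionOfLength {k : ℕ} {M : Type u} [AddCommGroup M] [Module R M]
    (h : FinProjResLE R k M) : HasResolutionOfLength R k M := by
  induction k generalizing M with
  | zero =>
    obtain ⟨_, _⟩ := h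
    refine ⟨fun i => match i with | 0 => .of R M | _ + 1 => .of R PUnit.{u + 1}, fun _ => 0, .id,
      ?_, ?_, ?_, ?_, ?_, Function.surjective_id⟩
    · rintro (_ | i)
      · assumption
      · exact inferInstanceAs (Module.Finite R PUnit.{u + 1})
    · rintro (_ | i)
      · assumption
      · exact inferInstanceAs (Module.Projective R PUnit.{u + 1})
    · rintro (_ | i) hi
      · simp at hi
      · exact inferInstanceAs (Subsingleton PUnit.{u + 1})
    · intro i x
      exact ⟨fun _ => ⟨0, rfl⟩, fun _ => rfl⟩
    · intro x
      simp [eq_comm]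
  | succ k ih =>
    obtain ⟨P, K, t, f, hP, hP', ⟨ht, htf, hf⟩, hK⟩ := h
    obtain ⟨Q, d, ε, hQ, hQ', h0, hd, hε, hs⟩ := ih hK
    refine ⟨fun i => match i with | 0 => P | i + 1 => Q i,
      fun i => match i with | 0 => t ∘ₗ ε | i + 1 => d i, f, ?_, ?_, ?_, ?_, ?_, hf⟩
    · rintro (_ | i)
      exacts [hP, hQ i]
    · rintro (_ | i)
      exacts [hP', hQ' i]
    · rintro (_ | i) hi
      · simp at hi
      · exact h0 i (by lia)
    · rintro (_ | i)
      · intro x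
        rw [← hε x]
        exact map_eq_zero_iff t ht
      · exact hd i
    · intro x
      rw [htf x]
      exact ⟨fun ⟨y, hy⟩ => (hs y).imp fun z hz => by simp [hz, hy],
        fun ⟨z, hz⟩ => ⟨ε z, hz⟩⟩

theorem hasResolutionOfLength_iff {k : ℕ} {M : Type u} [AddCommGroup M] [Module R M] :
    HasResolutionOfLength R k M ↔ FinProjResLE R k M :=
  ⟨fun h => h.finProjResLE, fun h => h.hasResolutionOfLength⟩

theorem natCast_lt_add_one_iff {k : ℕ} {n : ℕ∞} : (k : ℕ∞) < n + 1 ↔ (k : ℕ∞) ≤ n := by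
  induction n with
  | top => simp
  | coe n => norm_cast; exact Nat.lt_succ_iff

theorem classP_iff {n : ℕ∞} {M : Type u} [AddCommGroup M] [Module R M] :
    ClassP R n M ↔ ∃ k : ℕ, (k : ℕ∞) ≤ n ∧ FinProjResLE R k M := by
  simp only [ClassP, natCast_lt_add_one_iff, hasResolutionOfLength_iff]

theorem classP_natCast_iff {n : ℕ} {M : Type u} [AddCommGroup M] [Module R M] :
    ClassP R n M ↔ FinProjResLE R n M := by
  rw [classP_iff]
  exact ⟨fun ⟨k, hk, h⟩ => h.mono (by exact_mod_cast hk), fun h => ⟨n, le_rfl, h⟩⟩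

/-! ### Resolution length and projective dimension -/

theorem hasProjectiveDimensionLE_succ_iff_ker {P M : Type u} [AddCommGroup P] [Module R P]
    [Module.Projective R P] [AddCommGroup M] [Module R M] {f : P →ₗ[R] M}
    (hf : Function.Surjective f) (k : ℕ) :
    HasProjectiveDimensionLE (ModuleCat.of R M) (k + 1) ↔
      HasProjectiveDimensionLE (ModuleCat.of R (LinearMap.ker f)) k :=
  (LinearMap.shortExact_shortComplexKer hf).hasProjectiveDimensionLT_X₃_iff k
    ((IsProjective.iff_projective P).1 ‹_›)

theorem hasProjectiveDimensionLE_zero_iff {M : Type u} [AddCommGroup M] [Module R M] :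
    HasProjectiveDimensionLE (ModuleCat.of R M) 0 ↔ Module.Projective R M := by
  rw [← projective_iff_hasProjectiveDimensionLE_zero, ← IsProjective.iff_projective]

theorem FinProjResLE.hasProjectiveDimensionLE {k : ℕ} {M : Type u} [AddCommGroup M] [Module R M]
    (h : FinProjResLE R k M) : HasProjectiveDimensionLE (ModuleCat.of R M) k := by
  induction k generalizing M with
  | zero => exact hasProjectiveDimensionLE_zero_iff.2 h.2
  | succ k ih =>
    have := h.finite
    obtain ⟨s, f, hf⟩ := Module.Finite.exists_fin' R M
    exact (hasProjectiveDimensionLE_succ_iff_ker hf k).2 (ih (h.ker hf))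

/-- The resolution of length `k` serves only to keep all syzygies finitely generated; `n` controls
where they become projective. Passing through `succ` before `ker` covers `k = 0`. -/
theorem FinProjResLE.of_hasProjectiveDimensionLE {k n : ℕ} {M : Type u} [AddCommGroup M]
    [Module R M] (h : FinProjResLE R k M)
    (hn : HasProjectiveDimensionLE (ModuleCat.of R M) n) : FinProjResLE R n M := by
  induction n generalizing k M with
  | zero => exact ⟨h.finite, hasProjectiveDimensionLE_zero_iff.1 hn⟩
  | succ n ih =>
    have := h.finite
    obtain ⟨s, f, hf⟩ := Module.Finite.exists_fin' R M
    exact .succ_of_surjective hf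
      (ih (h.succ.ker hf) ((hasProjectiveDimensionLE_succ_iff_ker hf n).1 hn))

/-! ### Relative projectivity and closure properties of the class -/

theorem isHomExact_iff {A B C : Type u} [AddCommGroup A] [Module R A] [AddCommGroup B]
    [Module R B] [AddCommGroup C] [Module R C] {f : A →ₗ[R] B} {g : B →ₗ[R] C}
    (h : IsShortExact f g) {M : Type u} [AddCommGroup M] [Module R M] :
    IsHomExact M f g ↔ ∀ φ : M →ₗ[R] C, ∃ ψ : M →ₗ[R] B, g ∘ₗ ψ = φ := by
  refine ⟨fun h' => h'.2.2, fun h' => ⟨fun φ ψ e => ?_, fun ψ => ⟨fun e => ?_, ?_⟩, h'⟩⟩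
  · exact LinearMap.ext fun x => h.1 (LinearMap.congr_fun e x)
  · obtain ⟨e'⟩ := ker_equiv_of_isShortExact h
    have hr : ∀ x, ψ x ∈ LinearMap.range f := fun x => (h.2.1 _).1 (LinearMap.congr_fun e x)
    refine ⟨(LinearEquiv.ofInjective f h.1).symm.toLinearMap ∘ₗ ψ.codRestrict _ hr, ?_⟩
    ext x
    exact congrArg Subtype.val ((LinearEquiv.ofInjective f h.1).apply_symm_apply ⟨ψ x, hr x⟩)
  · rintro ⟨φ, rfl⟩
    exact LinearMap.ext fun x => h.2.1.apply_apply_eq_zero (φ x)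

section

variable {n : ℕ∞} {M N : Type u} [AddCommGroup M] [Module R M] [AddCommGroup N] [Module R N]

theorem ClassP.finite (h : ClassP R n M) : Module.Finite R M :=
  (classP_iff.1 h).elim fun _ h => h.2.finite

theorem ClassP.of_equiv (h : ClassP R n M) (e : M ≃ₗ[R] N) : ClassP R n N := by
  rw [classP_iff] at h ⊢
  exact h.imp fun _ h => ⟨h.1, h.2.of_equiv e⟩

theorem ClassP.of_retract (h : ClassP R n N) {i : M →ₗ[R] N} {r : N →ₗ[R] M}
    (hri : r ∘ₗ i = .id) : ClassP R n M := by
  rw [classP_iff] at h ⊢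
  exact h.imp fun _ h => ⟨h.1, h.2.of_retract hri⟩

theorem ClassP.prod (hM : ClassP R n M) (hN : ClassP R n N) : ClassP R n (M × N) := by
  rw [classP_iff] at hM hN ⊢
  obtain ⟨k, hk, hM⟩ := hM
  obtain ⟨l, hl, hN⟩ := hN
  refine ⟨max k l, ?_, (hM.mono (le_max_left k l)).prod (hN.mono (le_max_right k l))⟩
  rcases max_choice k l with h | h <;> rwa [h]

theorem ClassP.of_projective [Module.Finite R M] [Module.Projective R M] : ClassP R n M :=
  classP_iff.2 ⟨0, by simp, .of_projective 0⟩

theorem ClassP.mono {m : ℕ∞} (hnm : n ≤ m) (h : ClassP R n M) : ClassP R m M := by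
  rw [classP_iff] at h ⊢
  exact h.imp fun _ h => ⟨h.1.trans hnm, h.2⟩

theorem ClassP.isNProjective (h : ClassP R n M) : IsNProjective R n M :=
  fun _ _ _ _ _ _ _ _ _ _ _ hfg => hfg.2 M h

theorem IsNProjective.of_forall_classP {m : ℕ∞} (H : ∀ (X : Type u) [AddCommGroup X] [Module R X],
    ClassP R m X → ClassP R n X) (h : IsNProjective R m M) : IsNProjective R n M :=
  fun A B C _ _ _ _ _ _ f g hfg => h A B C f g ⟨hfg.1, fun X _ _ hX => hfg.2 X (H X hX)⟩

variable (n) in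
/-- The linear maps that factor through a module of the class `𝒫^{< n+1}`. -/
def FactorsThroughClassP (h : M →ₗ[R] N) : Prop :=
  ∃ (Y : ModuleCat.{u} R) (a : M →ₗ[R] Y) (b : Y →ₗ[R] N), ClassP R n Y ∧ b ∘ₗ a = h

theorem FactorsThroughClassP.zero : FactorsThroughClassP n (0 : M →ₗ[R] N) :=
  ⟨.of R PUnit, 0, 0, .of_projective, rfl⟩

theorem FactorsThroughClassP.add {g h : M →ₗ[R] N} (hg : FactorsThroughClassP n g)
    (hh : FactorsThroughClassP n h) : FactorsThroughClassP n (g + h) := by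
  obtain ⟨Y, a, b, hY, rfl⟩ := hg
  obtain ⟨Z, c, d, hZ, rfl⟩ := hh
  exact ⟨.of R (Y × Z), a.prod c, b.coprod d, hY.prod hZ, by ext; simp⟩

theorem FactorsThroughClassP.sum {ι : Type*} (s : Finset ι) {h : ι → M →ₗ[R] N}
    (hh : ∀ i ∈ s, FactorsThroughClassP n (h i)) : FactorsThroughClassP n (∑ i ∈ s, h i) :=
  Finset.sum_induction _ _ (fun _ _ => .add) .zero hh

variable (R n M) in
/-- A direct sum of modules of `𝒫^{< n+1}` over which every map from a module of this class to `M`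
lifts. -/
theorem exists_classP_precover :
    ∃ (ι : Type u) (X : ι → ModuleCat.{u} R) (p : ∀ i, X i →ₗ[R] M), (∀ i, ClassP R n (X i)) ∧
      ∀ (Y : Type u) [AddCommGroup Y] [Module R Y], ClassP R n Y → ∀ φ : Y →ₗ[R] M,
        ∃ (i : ι) (ψ : Y →ₗ[R] X i), p i ∘ₗ ψ = φ := by
  -- Members are finitely generated, so quotients of the `R^s` represent them all by a set in `Type
  -- u`; each is repeated once per map to `M`.
  refine ⟨Σ j : (Σ s : ℕ, {S : Submodule R (Fin s → R) // ClassP R n ((Fin s → R) ⧸ S)}),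
    ((Fin j.1 → R) ⧸ j.2.1) →ₗ[R] M, fun i => .of R ((Fin i.1.1 → R) ⧸ i.1.2.1), fun i => i.2,
    fun i => i.1.2.2, fun Y _ _ hY φ => ?_⟩
  have := hY.finite
  obtain ⟨s, f, hf⟩ := Module.Finite.exists_fin' R Y
  let e := f.quotKerEquivOfSurjective hf
  refine ⟨⟨⟨s, LinearMap.ker f, hY.of_equiv e.symm⟩, φ ∘ₗ e.toLinearMap⟩, e.symm.toLinearMap, ?_⟩
  ext y
  exact congrArg φ (e.apply_symm_apply y)

/-- The precover from a direct sum of members is the end of an `n`-exact sequence, so it splits.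
Finitely many generators meet finitely many summands, hence the identity of `M` factors through a
finite sum. -/
theorem IsNProjective.classP [Module.Finite R M] (h : IsNProjective R n M) : ClassP R n M := by
  classical
  obtain ⟨ι, X, p, hX, hp⟩ := exists_classP_precover R n M
  let g : (Π₀ i, X i) →ₗ[R] M := DFinsupp.lsum ℕ p
  have hlift : ∀ (Y : Type u) [AddCommGroup Y] [Module R Y], ClassP R n Y → ∀ φ : Y →ₗ[R] M,
      ∃ ψ : Y →ₗ[R] Π₀ i, X i, g ∘ₗ ψ = φ := by
    intro Y _ _ hY φ
    obtain ⟨i, ψ, rfl⟩ := hp Y hY φ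
    refine ⟨DFinsupp.lsingle i ∘ₗ ψ, ?_⟩
    ext y
    simp [g]
  have hg : Function.Surjective g := by
    intro x
    obtain ⟨ψ, hψ⟩ := hlift R .of_projective (LinearMap.toSpanSingleton R M x)
    exact ⟨ψ 1, by simpa using LinearMap.congr_fun hψ 1⟩
  have hs := isShortExact_ker_subtype hg
  obtain ⟨σ, hσ⟩ := (isHomExact_iff hs).1
    (h _ _ _ _ g ⟨hs, fun Y _ _ hY => (isHomExact_iff hs).2 (hlift Y hY)⟩) .id
  obtain ⟨T, hT⟩ := (Module.Finite.fg_top : (⊤ : Submodule R M).FG)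
  -- The summands met by the section `σ` on the generators.
  let F : Finset ι := T.biUnion fun x => (σ x).support
  have hF : ∑ i ∈ F, p i ∘ₗ DFinsupp.lapply i ∘ₗ σ = .id := by
    refine LinearMap.ext_on hT fun x hx => ?_
    have hx' : g (σ x) = x := LinearMap.congr_fun hσ x
    rw [LinearMap.id_apply]
    conv_rhs => rw [← hx']
    simp only [g, DFinsupp.lsum_apply_apply, DFinsupp.sumAddHom_apply, LinearMap.sum_apply]
    rw [DFinsupp.sum]
    refine (Finset.sum_subset (Finset.subset_biUnion_of_mem (fun x => (σ x).support) hx) ?_).symm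
    intro i _ hi
    have hi' : σ x i = 0 := by simpa using hi
    simp [hi']
  obtain ⟨Y, a, b, hY, hab⟩ : FactorsThroughClassP n (.id : M →ₗ[R] M) :=
    hF ▸ .sum F fun i _ => ⟨X i, _, p i, hX i, rfl⟩
  exact hY.of_retract hab

/-! ### Finitistic dimension -/

theorem projDim_le_iff : projDim R M ≤ (n : WithBot ℕ∞) ↔
    n = ⊤ ∨ ∃ k : ℕ, (k : ℕ∞) ≤ n ∧ HasProjectiveDimensionLE (ModuleCat.of R M) k := by
  induction n with
  | top => simp
  | coe n =>
    have := projectiveDimension_le_iff (ModuleCat.of R M) n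
    simp only [projDim, ENat.natCast_ne_top, false_or, Nat.cast_le]
    refine this.trans ⟨fun h => ⟨n, le_rfl, h⟩, fun ⟨k, hk, h⟩ => ?_⟩
    exact hasProjectiveDimensionLT_of_ge _ (k + 1) _ (by lia)

theorem projDim_lt_add_one_iff : projDim R M < ((n + 1 : ℕ∞) : WithBot ℕ∞) ↔
    ∃ k : ℕ, (k : ℕ∞) ≤ n ∧ HasProjectiveDimensionLE (ModuleCat.of R M) k := by
  induction n with
  | top => simpa [lt_top_iff_ne_top, projDim] using projectiveDimension_ne_top_iff (ModuleCat.of R M)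
  | coe n =>
    have := projDim_le_iff (R := R) (M := M) (n := n)
    simp only [ENat.natCast_ne_top, false_or] at this
    rw [← this]
    exact ENat.WithBot.lt_add_one_iff

end

theorem littleFinitisticDim_le_iff {n : ℕ∞} : littleFinitisticDim R ≤ (n : WithBot ℕ∞) ↔
    ∀ (M : Type u) [AddCommGroup M] [Module R M], ClassP R ⊤ M → ClassP R n M := by
  have key : littleFinitisticDim R ≤ (n : WithBot ℕ∞) ↔ ∀ (M : Type u) [AddCommGroup M]
      [Module R M], HasFiniteProjectiveResolution R M → projDim R M ≤ (n : WithBot ℕ∞) :=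
    iSup₂_le_iff.trans ⟨fun h M _ _ => h (.of R M), fun h M => h M⟩
  simp only [key, projDim_le_iff, HasFiniteProjectiveResolution, hasResolutionOfLength_iff,
    classP_iff, le_top, true_and]
  refine forall₃_congr fun M _ _ => forall_congr' fun ⟨k, hk⟩ =>
    ⟨?_, fun ⟨l, hl, h⟩ => .inr ⟨l, hl, h.hasProjectiveDimensionLE⟩⟩
  rintro (rfl | ⟨l, hl, h⟩)
  -- For `n = ∞` the dimension bound is vacuous, and the given resolution suffices.
  · exact ⟨k, le_top, hk⟩
  · exact ⟨l, hl, hk.of_hasProjectiveDimensionLE h⟩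

/-- Induction on the length of the resolution: once the syzygy has length `n`, the module has length
`n + 1`, and `H` shortens it back to `n`. -/
theorem classP_of_classP_top {n : ℕ∞} (H : ∀ (M : Type u) [AddCommGroup M] [Module R M],
    ClassP R (n + 1) M → ClassP R n M) (M : Type u) [AddCommGroup M] [Module R M]
    (hM : ClassP R ⊤ M) : ClassP R n M := by
  induction n with
  | top => exact hM
  | coe n =>
    obtain ⟨k, -, hM⟩ := classP_iff.1 hM
    rw [classP_natCast_iff]
    induction k generalizing M with
    | zero => exact hM.mono n.zero_le
    | succ k ih =>
      obtain ⟨P, K, i, f, hP, hP', hs, hK⟩ := hM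
      refine classP_natCast_iff.1 (H M ?_)
      exact (classP_natCast_iff (n := n + 1)).2
        ⟨P, K, i, f, hP, hP', hs, ih K (classP_iff.2 ⟨k, le_top, hK⟩) hK⟩

/-! ### Coherence and finitely presented modules -/

theorem IsLeftCoherent.finitePresentation_submodule (hR : IsLeftCoherent R) {s : ℕ}
    (N : Submodule R (Fin s → R)) (hN : N.FG) : Module.FinitePresentation R N := by
  induction s with
  | zero => exact Module.finitePresentation_of_projective R N
  | succ s ih =>
    have : Module.Finite R N := .of_fg hN
    -- The image of the first coordinate is a finitely generated ideal, hence finitely presented, so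
    -- the kernel is finitely generated. It embeds in `R^s`, and `N` is an extension of finitely
    -- presented modules.
    let p : N →ₗ[R] R := LinearMap.proj 0 ∘ₗ N.subtype
    have := hR (LinearMap.range p) (.of_finite)
    have hp := p.surjective_rangeRestrict
    have : Module.Finite R (LinearMap.ker p.rangeRestrict) :=
      .of_fg (Module.FinitePresentation.fg_ker _ hp)
    let t : LinearMap.ker p.rangeRestrict →ₗ[R] (Fin s → R) :=
      LinearMap.funLeft R R Fin.succ ∘ₗ N.subtype ∘ₗ (LinearMap.ker p.rangeRestrict).subtype
    have ht : Function.Injective t := by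
      rw [injective_iff_map_eq_zero]
      rintro ⟨⟨x, hx⟩, hx'⟩ h
      have h0 : x 0 = 0 := congrArg Subtype.val hx'
      ext i
      refine Fin.cases h0 (fun j => congrFun h j) i
    have := ih (LinearMap.range t) .of_finite
    have : Module.FinitePresentation R (LinearMap.ker p.rangeRestrict) :=
      .of_equiv (N := LinearMap.ker p.rangeRestrict) (LinearEquiv.ofInjective t ht).symm
    exact Module.finitePresentation_of_ker p.rangeRestrict hp

theorem IsLeftCoherent.finProjResLE (hR : IsLeftCoherent R) {k : ℕ} {M : Type u} [AddCommGroup M]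
    [Module R M] [Module.FinitePresentation R M]
    (h : HasProjectiveDimensionLE (ModuleCat.of R M) k) : FinProjResLE R k M := by
  induction k generalizing M with
  | zero => exact ⟨inferInstance, hasProjectiveDimensionLE_zero_iff.1 h⟩
  | succ k ih =>
    obtain ⟨s, f, hf⟩ := Module.Finite.exists_fin' R M
    have := hR.finitePresentation_submodule _ (Module.FinitePresentation.fg_ker f hf)
    exact .succ_of_surjective hf (ih ((hasProjectiveDimensionLE_succ_iff_ker hf k).1 h))

theorem FinProjResLE.finitePresentation {k : ℕ} {M : Type u} [AddCommGroup M] [Module R M]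
    (h : FinProjResLE R k M) : Module.FinitePresentation R M := by
  have := h.finite
  obtain ⟨s, f, hf⟩ := Module.Finite.exists_fin' R M
  have := (h.succ.ker hf).finite
  exact Module.finitePresentation_of_surjective f hf .of_finite

/-- A finitely generated ideal `I` is the first syzygy of the finitely presented module `R ⧸ I`, so
it inherits a finite resolution. -/
theorem isLeftCoherent_of_forall_classP {n : ℕ∞} (H : ∀ (M : Type u) [AddCommGroup M]
    [Module R M], Module.FinitePresentation R M → ClassP R n M) : IsLeftCoherent R := by
  intro I hI
  have hfp : Module.FinitePresentation R (R ⧸ I) :=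
    Module.finitePresentation_of_surjective I.mkQ I.mkQ_surjective (by rwa [Submodule.ker_mkQ])
  obtain ⟨k, -, hk⟩ := classP_iff.1 (H _ hfp)
  exact ((hk.succ.ker I.mkQ_surjective).of_equiv
    (LinearEquiv.ofEq _ _ I.ker_mkQ)).finitePresentation

theorem isLeftCoherent_and_projDim_lt_iff {n : ℕ∞} :
    (IsLeftCoherent R ∧ ∀ (M : Type u) [AddCommGroup M] [Module R M],
      Module.FinitePresentation R M → projDim R M < ((n + 1 : ℕ∞) : WithBot ℕ∞)) ↔
    ∀ (M : Type u) [AddCommGroup M] [Module R M],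
      Module.FinitePresentation R M → ClassP R n M := by
  refine ⟨fun ⟨hR, h⟩ M _ _ hM => ?_, fun h => ⟨isLeftCoherent_of_forall_classP h, ?_⟩⟩
  · obtain ⟨k, hk, hkM⟩ := projDim_lt_add_one_iff.1 (h M hM)
    exact classP_iff.2 ⟨k, hk, hR.finProjResLE hkM⟩
  · intro M _ _ hM
    obtain ⟨k, hk, hkM⟩ := classP_iff.1 (h M hM)
    exact projDim_lt_add_one_iff.2 ⟨k, hk, hkM.hasProjectiveDimensionLE⟩

end

end FiniteProjRes

/-- Here `n` and `m` range over the natural numbers together with `∞`, and `∞ + 1 = ∞`. For finite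
`n` the condition `n + 1 ≤ m` says that `m > n`; for `n = ∞` it says that `m = ∞`. -/
theorem corollary3p7 (R : Type u) [Ring R] (n : ℕ∞) :
    List.TFAE [
      FiniteProjRes.littleFinitisticDim R ≤ (n : WithBot ℕ∞),
      ∀ (M : Type u) [AddCommGroup M] [Module R M],
        FiniteProjRes.IsNProjective R (n + 1) M → FiniteProjRes.IsNProjective R n M,
      ∃ m : ℕ∞, n + 1 ≤ m ∧ ∀ (M : Type u) [AddCommGroup M] [Module R M],
        FiniteProjRes.IsNProjective R m M → FiniteProjRes.IsNProjective R n M,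
      ∀ m : ℕ∞, n + 1 ≤ m → ∀ (M : Type u) [AddCommGroup M] [Module R M],
        FiniteProjRes.IsNProjective R m M → FiniteProjRes.IsNProjective R n M,
      ∀ (M : Type u) [AddCommGroup M] [Module R M],
        FiniteProjRes.IsNProjective R ⊤ M → FiniteProjRes.IsNProjective R n M] ∧
    ((FiniteProjRes.IsLeftCoherent R ∧
        ∀ (M : Type u) [AddCommGroup M] [Module R M], Module.FinitePresentation R M →
          FiniteProjRes.projDim R M < ((n + 1 : ℕ∞) : WithBot ℕ∞)) ↔
      ∀ (M : Type u) [AddCommGroup M] [Module R M],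
        FiniteProjRes.IsPureProjective R M → FiniteProjRes.IsNProjective R n M) := by
  constructor
  -- It is enough to test the hypothesis on members of `𝒫^{<n+2}`: these are `m`-projective and
  -- finitely generated.
  · have imp_of_le {m : ℕ∞} (hm : n + 1 ≤ m) (h : ∀ (M : Type u) [AddCommGroup M] [Module R M],
        FiniteProjRes.IsNProjective R m M → FiniteProjRes.IsNProjective R n M) :
        FiniteProjRes.littleFinitisticDim R ≤ (n : WithBot ℕ∞) :=
      FiniteProjRes.littleFinitisticDim_le_iff.2 <|
        FiniteProjRes.classP_of_classP_top fun M _ _ hM =>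
          have := hM.finite
          (h M (hM.mono hm).isNProjective).classP
    tfae_have 1 → 4 := fun h m _ M _ _ hM => hM.of_forall_classP fun X _ _ hX =>
      FiniteProjRes.littleFinitisticDim_le_iff.1 h X (hX.mono le_top)
    tfae_have 4 → 2 := fun h => h _ le_rfl
    tfae_have 4 → 5 := fun h => h _ le_top
    tfae_have 2 → 3 := fun h => ⟨_, le_rfl, h⟩
    tfae_have 5 → 3 := fun h => ⟨_, le_top, h⟩
    tfae_have 3 → 1 := fun ⟨_, hm, h⟩ => imp_of_le hm h
    tfae_finish
  · rw [FiniteProjRes.isLeftCoherent_and_projDim_lt_iff]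
    refine ⟨fun h M _ _ hM A B C _ _ _ _ _ _ f g hfg => ?_, fun h M _ _ hM => ?_⟩
    · exact hM A B C f g ⟨hfg.1, fun X _ _ hX => hfg.2 X (h X hX)⟩
    · exact (h M fun _ _ _ _ _ _ _ _ _ _ _ hfg => hfg.2 M hM).classP
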